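/- The domination game on a finite simple undirected graph $G$ is played by two players, Dominator and Staller, who alternately select a vertex of $G$. Write $N[v]$ for the closed neighborhood of $v$ (the vertex $v$ together with its neighbors). The choice of $v_i$ in the $i$-th move is legal if it dominates at least one new vertex, that is, if $$N[v_i]\setminus\bigcup_{j=1}^{i-1}N[v_j]\neq\emptyset,$$ where $v_1,\dots,v_{i-1}$ are the vertices played before. The game ends as soon as the selected vertices $v_1,\dots,v_i$ satisfy $\bigcup_{j=1}^{i}N[v_j]=V(G)$; the number $i$ of moves is then the value of the game. Dominator wants to minimize the value of the game and Staller wants to maximize it. The game domination number $\gamma_g(G)$ is the value of the game when Dominator starts and both players play optimally. Theorem. If $G$ is a graph on $n$ vertices without isolated vertices, then $$\gamma_g(G)\le \frac{5}{8}\,n .$$ -/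

import Mathlib

namespace DominationGame

variable {V : Type*}

/-- `N[v]`: the vertex `v` together with its neighbours. -/
def closedNbhd (G : SimpleGraph V) (v : V) : Set V :=
  {w | w = v ∨ G.Adj v w}

/-- `N[S]`: the set of vertices dominated by the vertices of `S`. -/
def dominated (G : SimpleGraph V) (S : Set V) : Set V :=
  ⋃ v ∈ S, closedNbhd G v

/-- When `D` is the set of vertices played so far, choosing `v` is legal if `v` dominates at
least one new vertex. -/
def Legal (G : SimpleGraph V) (D : Set V) (v : V) : Prop :=
  (closedNbhd G v \ dominated G D).Nonempty

/-- As long as the game is not over, there is a legal move. -/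
theorem exists_legal (G : SimpleGraph V) {D : Set V} (h : dominated G D ≠ Set.univ) :
    ∃ v, Legal G D v := by
  obtain ⟨v, hv⟩ := (Set.ne_univ_iff_exists_notMem _).1 h
  exact ⟨v, v, Or.inl rfl, hv⟩

/-- A legal move makes the set of undominated vertices strictly smaller. -/
theorem ncard_compl_dominated_lt [Finite V] (G : SimpleGraph V) {D : Set V} {v : V}
    (h : Legal G D v) :
    (dominated G (insert v D))ᶜ.ncard < (dominated G D)ᶜ.ncard := by
  have e : dominated G (insert v D) = closedNbhd G v ∪ dominated G D := Set.biUnion_insert _ _ _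
  obtain ⟨w, hw, hw'⟩ := h
  refine Set.ncard_lt_ncard ⟨?_, fun hs => ?_⟩ (Set.toFinite _)
  · rw [e]
    exact Set.compl_subset_compl.2 Set.subset_union_right
  · have := hs hw'
    rw [e] at this
    exact this (Or.inl hw)

/-- The two players. -/
inductive Player
  | dominator
  | staller

open Classical in
/-- The number of further moves made in the domination game on `G` under optimal play, when `D` is
the set of vertices played so far and the given player is to move. The game is over as soon as
every vertex is dominated; otherwise Dominator chooses a legal move minimizing, and Staller one
maximizing, the number of moves. -/
noncomputable def movesLeft [Fintype V] (G : SimpleGraph V) (p : Player) (D : Set V) : ℕ :=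
  if h : dominated G D = Set.univ then 0
  else
    have hne : (Finset.univ : Finset {v // Legal G D v}).Nonempty :=
      let ⟨v, hv⟩ := exists_legal G h
      ⟨⟨v, hv⟩, Finset.mem_univ _⟩
    match p with
    | .dominator => 1 + Finset.univ.inf' hne fun v => movesLeft G .staller (insert v.1 D)
    | .staller => 1 + Finset.univ.sup' hne fun v => movesLeft G .dominator (insert v.1 D)
termination_by (dominated G D)ᶜ.ncard
decreasing_by all_goals exact ncard_compl_dominated_lt G v.2

/-- The game domination number `γ_g(G)`: the number of moves in the domination game on `G` when
Dominator starts and both players play optimally. -/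
noncomputable def gameDominationNumber [Fintype V] (G : SimpleGraph V) : ℕ :=
  movesLeft G .dominator ∅

end DominationGame

/-! Let W be the set of undominated vertices. A potential that equals 5n at the start is to fall by
8 per move on average. It charges 5 for each vertex of W, plus a price for each trace, that is, each
distinct nonempty set N(x) ∩ W with x dominated.

If a move newly dominates A, at most |A| traces arise. One unit is always saved: a played vertex of
W leaves an empty trace, and a played dominated vertex destroys its own. At price 3 the drop is at
least 5|A| - 3(|A| - 1) = 2|A| + 3 ≥ 5. Thus Staller concedes 5, and Dominator wants 11, since 5 +
11 = 2·8. A smaller drop also suffices if two moves total 16, or three moves total 27 = 16 + 11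
(`GoodMove`).

First phase (`movesLeft_le_initialWeight`): traces cost 4. Dominator plays undominated support
vertices that have an undominated neighbour besides a leaf. When none is left, the position is
`Paired`. The price then becomes 3, plus 1 for traces with two support vertices; this does not raise
the potential.

Second phase (`exists_goodMove`): suppose no move drops 11. A vertex with two neighbours in W is a
good move (`Stuck.goodMove_of_two_le`). Otherwise W induces isolated vertices and edges. If there
are no edges, every move drops 8. Without a good move, each edge would have exactly one link, at a
support vertex. A link then joins two support vertices, and destroying this double trace supplies
the missing unit (`Stuck.exists_goodMove_of_edge`). -/

namespace DominationGame

open Finset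

/-! ### Traces and the drop of the potential -/

section Potential

set_option linter.unusedSectionVars false

variable {V : Type*} [Fintype V] [DecidableEq V] (G : SimpleGraph V) [DecidableRel G.Adj]

/-- The neighbours of `v` in the set `W` of undominated vertices. -/
def whiteNbrs (W : Finset V) (v : V) : Finset V := W.filter (G.Adj v)

/-- The vertices of `W` dominated by playing `v`. -/
def hits (W : Finset V) (v : V) : Finset V := W.filter fun w => w = v ∨ G.Adj v w

/-- The undominated vertices left after playing `v`. -/
def play (W : Finset V) (v : V) : Finset V := W \ hits G W v

/-- The nonempty sets of undominated neighbours of dominated vertices. -/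
def traces (W : Finset V) : Finset (Finset V) := (Wᶜ.image (whiteNbrs G W)).erase ∅

/-- `p` is a leaf whose only neighbour is `h`. -/
def IsPendant (p h : V) : Prop := ∀ w, G.Adj p w ↔ w = h

instance (p h : V) : Decidable (IsPendant G p h) := by unfold IsPendant; infer_instance

/-- The vertices adjacent to a leaf. -/
def supports : Finset V := univ.filter fun h => ∃ p, IsPendant G p h

/-- The traces containing at least two support vertices. -/
def doubleTraces (W : Finset V) : Finset (Finset V) :=
  (traces G W).filter fun S => 2 ≤ (S ∩ supports G).card

/-- The potential controlling the second phase of Dominator's strategy. -/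
def weight (W : Finset V) : ℕ :=
  5 * W.card + 3 * (traces G W).card + (doubleTraces G W).card

/-- Every undominated support vertex has exactly one undominated neighbour, its leaf. -/
def Paired (W : Finset V) : Prop :=
  ∀ h ∈ W, ∀ p, IsPendant G p h → whiteNbrs G W h = {p}

variable {G} {W A : Finset V} {u v w : V}

@[simp] lemma mem_whiteNbrs : w ∈ whiteNbrs G W v ↔ w ∈ W ∧ G.Adj v w := by
  simp [whiteNbrs]

@[simp] lemma mem_hits : w ∈ hits G W v ↔ w ∈ W ∧ (w = v ∨ G.Adj v w) := by
  simp [hits]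

lemma mem_play : w ∈ play G W v ↔ w ∈ W ∧ ¬ (w = v ∨ G.Adj v w) := by
  simp only [play, mem_sdiff, mem_hits]; tauto

lemma hits_subset : hits G W v ⊆ W := filter_subset _ _

lemma hits_of_mem (hv : v ∈ W) : hits G W v = insert v (whiteNbrs G W v) := by
  ext w; simp only [mem_hits, mem_insert, mem_whiteNbrs]
  constructor
  · tauto
  · rintro (rfl | h)
    · exact ⟨hv, Or.inl rfl⟩
    · tauto

lemma hits_of_notMem (hv : v ∉ W) : hits G W v = whiteNbrs G W v := by
  ext w; simp only [mem_hits, mem_whiteNbrs]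
  constructor
  · rintro ⟨h, rfl | h'⟩
    · exact (hv h).elim
    · exact ⟨h, h'⟩
  · tauto

lemma notMem_whiteNbrs_self : v ∉ whiteNbrs G W v := by simp

lemma card_hits_of_mem (hv : v ∈ W) : (hits G W v).card = (whiteNbrs G W v).card + 1 := by
  rw [hits_of_mem hv, card_insert_of_notMem notMem_whiteNbrs_self]

@[simp] lemma whiteNbrs_sdiff : whiteNbrs G (W \ A) v = whiteNbrs G W v \ A := by
  ext w; simp; tauto

lemma mem_whiteNbrs_comm (hv : v ∈ W) (h : w ∈ whiteNbrs G W v) : v ∈ whiteNbrs G W w := by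
  simp only [mem_whiteNbrs] at h ⊢; exact ⟨hv, h.2.symm⟩

lemma mem_traces {S : Finset V} :
    S ∈ traces G W ↔ S.Nonempty ∧ ∃ x, x ∉ W ∧ whiteNbrs G W x = S := by
  simp [traces, nonempty_iff_ne_empty]

lemma subset_of_mem_traces {S : Finset V} (hS : S ∈ traces G W) : S ⊆ W := by
  obtain ⟨-, x, -, rfl⟩ := mem_traces.1 hS
  exact filter_subset _ _

lemma exists_hits_eq_of_mem_traces {S : Finset V} (hS : S ∈ traces G W) :
    ∃ x, hits G W x = S := by
  obtain ⟨-, x, hx, rfl⟩ := mem_traces.1 hS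
  exact ⟨x, hits_of_notMem hx⟩

lemma sdiff_mem_traces {S : Finset V} (hS : S ∈ traces G W) (h : (S \ A).Nonempty) :
    S \ A ∈ traces G (W \ A) := by
  obtain ⟨-, x, hx, rfl⟩ := mem_traces.1 hS
  refine mem_traces.2 ⟨h, x, ?_, whiteNbrs_sdiff⟩
  simp [hx]

lemma mem_traces_sdiff_singleton {S : Finset V} {t : V} (hS : S ∈ traces G W) (ht : t ∉ S) :
    S ∈ traces G (W \ {t}) := by
  have e : S \ {t} = S := sdiff_eq_self_of_disjoint (disjoint_singleton_right.2 ht)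
  have := sdiff_mem_traces (A := {t}) hS (by rw [e]; exact (mem_traces.1 hS).1)
  rwa [e] at this

lemma whiteNbrs_sdiff_mem_traces (hu : u ∈ A) (h : (whiteNbrs G W u \ A).Nonempty) :
    whiteNbrs G W u \ A ∈ traces G (W \ A) :=
  mem_traces.2 ⟨h, u, by simp [hu], whiteNbrs_sdiff⟩

lemma eq_sdiff_of_mem_traces_sdiff {S : Finset V} (hS : S ∈ traces G (W \ A)) :
    (∃ T ∈ traces G W, T \ A = S) ∨ ∃ u ∈ A, whiteNbrs G W u \ A = S := by
  obtain ⟨hne, x, hx, rfl⟩ := mem_traces.1 hS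
  rw [whiteNbrs_sdiff] at hne ⊢
  by_cases hA : x ∈ A
  · exact Or.inr ⟨x, hA, rfl⟩
  · refine Or.inl ⟨_, mem_traces.2 ⟨hne.mono sdiff_subset, x, fun h => hx ?_, rfl⟩, rfl⟩
    simp [h, hA]

/-- Traces in `K` vanish or merge with another trace; vertices of `R` give no new trace. -/
lemma card_traces_sdiff_le (K : Finset (Finset V)) (R : Finset V)
    (hK : ∀ S ∈ K, S ∈ traces G W ∧
      (S ⊆ A ∨ ∃ T ∈ traces G W, T ∉ K ∧ T \ A = S \ A))
    (hR : ∀ u ∈ R, u ∈ A ∧ (whiteNbrs G W u ⊆ A ∨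
      (∃ S ∈ traces G W, S \ A = whiteNbrs G W u \ A) ∨
      ∃ u' ∈ A, u' ∉ R ∧ whiteNbrs G W u' \ A = whiteNbrs G W u \ A)) :
    (traces G (W \ A)).card + K.card + R.card ≤ (traces G W).card + A.card := by
  have hsub : traces G (W \ A) ⊆
      (traces G W \ K).image (· \ A) ∪ (A \ R).image (fun u => whiteNbrs G W u \ A) := by
    intro S hS
    have hne := (mem_traces.1 hS).1
    have key : ∀ T ∈ traces G W, T \ A = S → S ∈ (traces G W \ K).image (· \ A) := by
      intro T hT hTS
      by_cases hTK : T ∈ K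
      · rcases (hK T hTK).2 with h | ⟨T', hT', hT'K, h⟩
        · rw [sdiff_eq_empty_iff_subset.2 h] at hTS
          exact (hne.ne_empty hTS.symm).elim
        · exact mem_image.2 ⟨T', mem_sdiff.2 ⟨hT', hT'K⟩, h.trans hTS⟩
      · exact mem_image.2 ⟨T, mem_sdiff.2 ⟨hT, hTK⟩, hTS⟩
    rcases eq_sdiff_of_mem_traces_sdiff hS with ⟨T, hT, hTS⟩ | ⟨u, hu, huS⟩
    · exact mem_union_left _ (key T hT hTS)
    · by_cases huR : u ∈ R
      · rcases (hR u huR).2 with h | ⟨T, hT, h⟩ | ⟨u', hu', hu'R, h⟩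
        · rw [sdiff_eq_empty_iff_subset.2 h] at huS
          exact (hne.ne_empty huS.symm).elim
        · exact mem_union_left _ (key T hT (h.trans huS))
        · exact mem_union_right _ (mem_image.2 ⟨u', mem_sdiff.2 ⟨hu', hu'R⟩, h.trans huS⟩)
      · exact mem_union_right _ (mem_image.2 ⟨u, mem_sdiff.2 ⟨hu, huR⟩, huS⟩)
  have h1 := (card_le_card hsub).trans (card_union_le _ _)
  have h2 : ((traces G W \ K).image (· \ A)).card ≤ (traces G W \ K).card := card_image_le
  have h3 : ((A \ R).image (fun u => whiteNbrs G W u \ A)).card ≤ (A \ R).card := card_image_le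
  have h4 := card_sdiff_add_card_eq_card (fun S hS => (hK S hS).1 : K ⊆ traces G W)
  have h5 := card_sdiff_add_card_eq_card (fun u hu => (hR u hu).1 : R ⊆ A)
  omega

/-- An undominated support neighbour h of u has its leaf as sole undominated neighbour, so u is that
leaf; a leaf has only one neighbour. Hence newly dominated vertices never produce double traces. -/
lemma Paired.card_inter_supports_lt (hW : Paired G W) (hu : u ∈ W) :
    (whiteNbrs G W u ∩ supports G).card < 2 := by
  rw [Nat.lt_succ_iff, card_le_one]
  have key : ∀ h ∈ whiteNbrs G W u ∩ supports G, IsPendant G u h := by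
    intro h hh
    simp only [mem_inter, supports, mem_filter, mem_univ, true_and] at hh
    obtain ⟨hh, p, hp⟩ := hh
    have hu' := mem_whiteNbrs_comm hu hh
    rw [hW h (mem_whiteNbrs.1 hh).1 p hp, mem_singleton] at hu'
    exact hu' ▸ hp
  intro a ha b hb
  exact ((key b hb) a).1 (mem_whiteNbrs.1 (mem_inter.1 ha).1).2

lemma Paired.doubleTraces_sdiff_subset (hW : Paired G W) (hA : A ⊆ W) :
    doubleTraces G (W \ A) ⊆
      ((doubleTraces G W).filter fun S => 2 ≤ ((S \ A) ∩ supports G).card).image (· \ A) := by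
  intro S hS
  obtain ⟨hS, h2⟩ := mem_filter.1 hS
  rcases eq_sdiff_of_mem_traces_sdiff hS with ⟨T, hT, rfl⟩ | ⟨u, hu, rfl⟩
  · refine mem_image.2 ⟨T, mem_filter.2 ⟨mem_filter.2 ⟨hT, h2.trans (card_le_card ?_)⟩, h2⟩, rfl⟩
    exact inter_subset_inter_right sdiff_subset
  · have h3 := hW.card_inter_supports_lt (hA hu)
    have h4 := card_le_card
      (inter_subset_inter_right sdiff_subset : (whiteNbrs G W u \ A) ∩ supports G ⊆ _)
    omega

lemma Paired.card_doubleTraces_sdiff_le (hW : Paired G W) (hA : A ⊆ W) :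
    (doubleTraces G (W \ A)).card ≤ (doubleTraces G W).card :=
  ((card_le_card (hW.doubleTraces_sdiff_subset hA)).trans card_image_le).trans
    (card_le_card (filter_subset _ _))

lemma Paired.card_doubleTraces_sdiff_lt (hW : Paired G W) (hA : A ⊆ W) {S : Finset V}
    (hS : S ∈ doubleTraces G W) (h : ((S \ A) ∩ supports G).card < 2) :
    (doubleTraces G (W \ A)).card < (doubleTraces G W).card := by
  refine ((card_le_card (hW.doubleTraces_sdiff_subset hA)).trans card_image_le).trans_lt
    (card_lt_card ⟨filter_subset _ _, fun hs => ?_⟩)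
  have := (mem_filter.1 (hs hS)).2
  omega

/-- The bookkeeping estimate behind all the constants: 5 - 3 = 2 per dominated vertex, and 3 more
for each trace lost (`K`) or not created (`R`). -/
lemma Paired.weight_sdiff_le (hW : Paired G W) (hA : A ⊆ W) (K : Finset (Finset V))
    (R : Finset V)
    (hK : ∀ S ∈ K, S ∈ traces G W ∧
      (S ⊆ A ∨ ∃ T ∈ traces G W, T ∉ K ∧ T \ A = S \ A))
    (hR : ∀ u ∈ R, u ∈ A ∧ (whiteNbrs G W u ⊆ A ∨
      (∃ S ∈ traces G W, S \ A = whiteNbrs G W u \ A) ∨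
      ∃ u' ∈ A, u' ∉ R ∧ whiteNbrs G W u' \ A = whiteNbrs G W u \ A)) :
    weight G (W \ A) + (2 * A.card + 3 * K.card + 3 * R.card) ≤ weight G W := by
  have h1 := card_traces_sdiff_le K R hK hR
  have h2 := hW.card_doubleTraces_sdiff_le hA
  have h3 := card_sdiff_add_card_eq_card hA
  simp only [weight]
  omega

lemma paired_play (hW : Paired G W) (v : V) : Paired G (play G W v) := by
  intro h hh p hp
  have hh' := mem_play.1 hh
  have := hW h hh'.1 p hp
  rw [play, whiteNbrs_sdiff, this]
  ext q
  simp only [mem_sdiff, mem_singleton, mem_hits, and_iff_left_iff_imp]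
  rintro rfl ⟨-, rfl | h3⟩
  · exact hh'.2 (Or.inr ((hp h).2 rfl))
  · exact hh'.2 (Or.inl ((hp v).1 h3.symm).symm)

/-- A move dominating `A` lowers the weight by at least `2|A| + 3`. -/
lemma Paired.weight_play_le (hW : Paired G W) (hv : (hits G W v).Nonempty) :
    weight G (play G W v) + (2 * (hits G W v).card + 3) ≤ weight G W := by
  by_cases hvW : v ∈ W
  · have := hW.weight_sdiff_le (hits_subset (G := G) (v := v)) ∅ {v} (by simp) (by
      simp only [mem_singleton, forall_eq]
      refine ⟨by simp [hvW], Or.inl ?_⟩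
      rw [hits_of_mem hvW]; exact subset_insert _ _)
    simpa [play] using this
  · have := hW.weight_sdiff_le (hits_subset (G := G) (v := v)) {hits G W v} ∅ (by
      simp only [mem_singleton, forall_eq]
      refine ⟨mem_traces.2 ⟨hv, v, hvW, (hits_of_notMem hvW).symm⟩, Or.inl subset_rfl⟩) (by simp)
    simpa [play] using this

lemma Paired.weight_play_add_le (hW : Paired G W) (B : Finset V) (K : Finset (Finset V))
    (R : Finset V) (hB : B ⊆ hits G W v)
    (hK : ∀ S ∈ K, S ∈ traces G W ∧ (S ⊆ hits G W v ∨
      ∃ T ∈ traces G W, T ∉ K ∧ T \ hits G W v = S \ hits G W v))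
    (hR : ∀ u ∈ R, u ∈ hits G W v ∧ (whiteNbrs G W u ⊆ hits G W v ∨
      (∃ S ∈ traces G W, S \ hits G W v = whiteNbrs G W u \ hits G W v) ∨
      ∃ u' ∈ hits G W v, u' ∉ R ∧
        whiteNbrs G W u' \ hits G W v = whiteNbrs G W u \ hits G W v)) :
    weight G (play G W v) + (2 * B.card + 3 * K.card + 3 * R.card) ≤ weight G W := by
  have h1 := hW.weight_sdiff_le (hits_subset (G := G) (v := v)) K R hK hR
  have h2 := card_le_card hB
  simp only [play]
  omega

/-- Dominating one vertex `t` of a singleton trace lowers the weight by `8` if this creates no new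
trace. -/
lemma Paired.weight_sdiff_singleton_le (hW : Paired G W) {t : V} (ht : {t} ∈ traces G W)
    (h : whiteNbrs G W t = ∅ ∨ whiteNbrs G W t ∈ traces G W) :
    weight G (W \ {t}) + 8 ≤ weight G W := by
  have := hW.weight_sdiff_le (subset_of_mem_traces ht) {{t}} {t} (by simp [ht]) (by
    simp only [mem_singleton, forall_eq, true_and]
    rcases h with h | h
    · simp [h]
    · exact Or.inr (Or.inl ⟨_, h, rfl⟩))
  simpa using this

/-- Removing `t` merges `{u, t}` into `{u}`. With a second saving, from `t` giving no trace or from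
`{t}` vanishing, the drop is 2 + 3 + 3. -/
lemma Paired.weight_sdiff_singleton_le_of_merge (hW : Paired G W) {t u : V} (htu : u ≠ t)
    (ht : t ∈ W) (hu : {u} ∈ traces G W) (hut : {u, t} ∈ traces G W)
    (h : whiteNbrs G W t = ∅ ∨ {t} ∈ traces G W) :
    weight G (W \ {t}) + 8 ≤ weight G W := by
  have hsub : ({t} : Finset V) ⊆ W := by simpa using ht
  have e1 : ({u} : Finset V) \ {t} = {u, t} \ {t} := by
    ext; simp; tauto
  have n1 : ({u} : Finset V) ≠ {u, t} := by
    intro h; have : t ∈ ({u} : Finset V) := by rw [h]; simp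
    exact htu (mem_singleton.1 this).symm
  have n2 : ({t} : Finset V) ≠ {u, t} := by
    intro h; have : u ∈ ({t} : Finset V) := by rw [h]; simp
    exact htu (mem_singleton.1 this)
  rcases h with h | h
  · have := hW.weight_sdiff_le hsub {{u, t}} {t} (by
      simp only [mem_singleton, forall_eq]
      exact ⟨hut, Or.inr ⟨_, hu, n1, e1⟩⟩) (by simp [h])
    simpa using this
  · have := hW.weight_sdiff_le hsub {{t}, {u, t}} ∅ (by
      intro S hS
      simp only [mem_insert, mem_singleton] at hS
      rcases hS with rfl | rfl
      · exact ⟨h, Or.inl subset_rfl⟩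
      · refine ⟨hut, Or.inr ⟨_, hu, ?_, e1⟩⟩
        simp only [mem_insert, mem_singleton, not_or]
        exact ⟨by simpa using htu, n1⟩) (by simp)
    rw [card_pair n2] at this
    simpa using this

/-- Two vertices that give no new trace and one destroyed trace: 2·2 + 3·2 + 3 = 13. -/
lemma Paired.weight_play_le_of_edge (hW : Paired G W) {q q' : V} {S : Finset V} (hq : q ∈ W)
    (hq' : q' ∈ whiteNbrs G W q) (h : whiteNbrs G W q' ⊆ hits G W q)
    (hS : S ∈ traces G W) (hSq : S ⊆ hits G W q) :
    weight G (play G W q) + 13 ≤ weight G W := by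
  have hne : q ≠ q' := fun e => by simp [← e] at hq'
  have e := hits_of_mem (G := G) hq
  have := hW.weight_play_add_le {q, q'} {S} {q, q'}
    (by rw [e]; intro y hy; simp only [mem_insert, mem_singleton] at hy ⊢
        rcases hy with rfl | rfl <;> tauto)
    (by simp only [mem_singleton, forall_eq]; exact ⟨hS, Or.inl hSq⟩)
    (by intro y hy
        simp only [mem_insert, mem_singleton] at hy
        rcases hy with rfl | rfl
        · refine ⟨by rw [e]; simp, Or.inl ?_⟩
          rw [e]; exact subset_insert _ _
        · exact ⟨by rw [e]; exact mem_insert_of_mem hq', Or.inl h⟩)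
  rw [card_pair hne] at this
  simpa using this

/-- Two destroyed traces and one vertex that gives no trace: 2·2 + 3·2 + 3 = 13. -/
lemma Paired.weight_play_le_of_trace (hW : Paired G W) {u w x : V} (huw : u ≠ w)
    (hx : hits G W x = {u, w}) (h : whiteNbrs G W u = ∅)
    (hu : {u} ∈ traces G W) (hw : {u, w} ∈ traces G W) :
    weight G (play G W x) + 13 ≤ weight G W := by
  have n : ({u} : Finset V) ≠ {u, w} := by
    intro h; have : w ∈ ({u} : Finset V) := by rw [h]; simp
    exact huw (mem_singleton.1 this).symm
  have := hW.weight_play_add_le {u, w} {{u}, {u, w}} {u} hx.ge (by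
      intro S hS
      simp only [mem_insert, mem_singleton] at hS
      rcases hS with rfl | rfl
      · exact ⟨hu, Or.inl (by rw [hx]; simp)⟩
      · exact ⟨hw, Or.inl hx.ge⟩) (by simp [hx, h])
  rw [card_pair n, card_pair huw] at this
  simpa using this

/-- A move dominates a single vertex or lowers the weight by at least `7`. -/
lemma Paired.reply (hW : Paired G W) {s : V} (hs : (hits G W s).Nonempty) :
    weight G (play G W s) + 7 ≤ weight G W ∨ ∃ t ∈ W, play G W s = W \ {t} ∧
      weight G (W \ {t}) + 5 ≤ weight G W ∧ (whiteNbrs G W t = ∅ ∨ {t} ∈ traces G W) := by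
  have h := hW.weight_play_le hs
  have hpos := hs.card_pos
  by_cases h2 : 2 ≤ (hits G W s).card
  · left; omega
  · right
    obtain ⟨t, ht⟩ := card_eq_one.1 (show (hits G W s).card = 1 by omega)
    have htW : t ∈ W := hits_subset (ht ▸ mem_singleton_self t : t ∈ hits G W s)
    have hp : play G W s = W \ {t} := by rw [play, ht]
    refine ⟨t, htW, hp, ?_, ?_⟩
    · rw [← hp]; omega
    · by_cases hsW : s ∈ W
      · left
        have hc := card_hits_of_mem (G := G) hsW
        have hst : s ∈ hits G W s := by simp [hsW]
        rw [ht, mem_singleton] at hst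
        rw [ht, card_singleton] at hc
        rw [← hst, ← card_eq_zero]
        omega
      · right
        exact mem_traces.2 ⟨by simp, s, hsW, by rw [← hits_of_notMem hsW, ht]⟩

end Potential

end DominationGame
namespace DominationGame

open Finset

/-! ### Good moves at vertices with two undominated neighbours -/

section Stuck

set_option linter.unusedSectionVars false

variable {V : Type*} [Fintype V] [DecidableEq V] {G : SimpleGraph V} [DecidableRel G.Adj]
  {W : Finset V} {u v w : V}

variable (G) in
/-- Playing `v` lowers the weight enough: on its own, or together with Staller's answer, or
together with Staller's answer and the next move of Dominator. -/
def GoodMove (W : Finset V) (v : V) : Prop :=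
  weight G (play G W v) + 11 ≤ weight G W ∨
  (weight G (play G W v) + 8 ≤ weight G W ∧ ∀ s, (hits G (play G W v) s).Nonempty →
    weight G (play G (play G W v) s) + 16 ≤ weight G W ∨
    ∃ d, (hits G (play G (play G W v) s) d).Nonempty ∧
      weight G (play G (play G (play G W v) s) d) + 27 ≤ weight G W)

variable (G) in
/-- No move lowers the weight by `11`. -/
def Stuck (W : Finset V) : Prop :=
  ∀ v, (hits G W v).Nonempty → weight G W < weight G (play G W v) + 11

lemma hits_nonempty_of_mem (hv : v ∈ W) : (hits G W v).Nonempty := ⟨v, by simp [hv]⟩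

/-- It suffices to answer the moves of Staller that dominate a single vertex. -/
lemma Paired.goodMove (hW : Paired G W)
    (h1 : weight G (play G W v) + 9 ≤ weight G W)
    (h : ∀ t ∈ play G W v, Paired G (play G W v \ {t}) →
      (whiteNbrs G (play G W v) t = ∅ ∨ {t} ∈ traces G (play G W v)) →
      weight G (play G W v \ {t}) + 8 ≤ weight G (play G W v) ∨
      ∃ d, (hits G (play G W v \ {t}) d).Nonempty ∧
        weight G (play G (play G W v \ {t}) d) + 13 ≤ weight G (play G W v \ {t})) :
    GoodMove G W v := by
  refine Or.inr ⟨by omega, fun s hs => ?_⟩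
  rcases (paired_play hW v).reply hs with h7 | ⟨t, ht, hp, h5, h'⟩
  · left; omega
  · rw [hp]
    rcases h t ht (hp ▸ paired_play (paired_play hW v) s) h' with h8 | ⟨d, hd, h13⟩
    · left; omega
    · exact Or.inr ⟨d, hd, by omega⟩

lemma Stuck.card_whiteNbrs_le_two (hst : Stuck G W) (hW : Paired G W) (hv : v ∈ W) :
    (whiteNbrs G W v).card ≤ 2 := by
  have h1 := hW.weight_play_le (hits_nonempty_of_mem (G := G) hv)
  have h2 := hst v (hits_nonempty_of_mem hv)
  rw [card_hits_of_mem hv] at h1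
  omega

/-- Neither `a` nor `b` would leave a trace after playing `b`, so 2|A| + 6 < 11 forces |A| ≤ 2. -/
lemma Stuck.card_whiteNbrs_le_one (hst : Stuck G W) (hW : Paired G W) {a b : V} (hb : b ∈ W)
    (ha : a ∈ whiteNbrs G W b) (h : whiteNbrs G W a ⊆ hits G W b) :
    (whiteNbrs G W b).card ≤ 1 := by
  have hne : b ≠ a := fun e => by simp [← e] at ha
  have h1 := hW.weight_play_add_le (v := b) (hits G W b) ∅ {b, a} subset_rfl (by simp) (by
    intro y hy
    simp only [mem_insert, mem_singleton] at hy
    rw [hits_of_mem hb] at h ⊢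
    rcases hy with rfl | rfl
    · exact ⟨by simp, Or.inl (subset_insert _ _)⟩
    · exact ⟨mem_insert_of_mem ha, Or.inl h⟩)
  have h2 := hst b (hits_nonempty_of_mem hb)
  rw [card_pair hne, card_hits_of_mem hb, card_empty] at h1
  omega

lemma Stuck.exists_next (hst : Stuck G W) (hW : Paired G W) {a : V} (hv : v ∈ W)
    (ha : a ∈ whiteNbrs G W v) (h : 2 ≤ (whiteNbrs G W v).card) :
    ∃ a' ∈ W, a' ∉ hits G W v ∧ whiteNbrs G W a = {v, a'} := by
  by_cases hs : whiteNbrs G W a ⊆ hits G W v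
  · have := hst.card_whiteNbrs_le_one hW hv ha hs
    omega
  · obtain ⟨a', h1, h2⟩ := not_subset.1 hs
    have haW := (mem_whiteNbrs.1 ha).1
    refine ⟨a', (mem_whiteNbrs.1 h1).1, h2, (eq_of_subset_of_card_le ?_ ?_).symm⟩
    · intro y hy
      simp only [mem_insert, mem_singleton] at hy
      rcases hy with rfl | rfl
      · exact mem_whiteNbrs_comm hv ha
      · exact h1
    · have hne : v ≠ a' := by
        rintro rfl; exact h2 (by simp [hv])
      rw [card_pair hne]
      exact hst.card_whiteNbrs_le_two hW haW

-- Playing `v` drops 9 and leaves singleton traces beyond both neighbours. A reply dominating two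
-- vertices drops 7, which suffices. Against a reply dominating one vertex `t`, either that reply
-- drops 8, or Dominator next gains 13 from an untouched side: 9 + 5 + 13 = 27.
set_option maxHeartbeats 800000 in
lemma Stuck.goodMove_of_two_le (hst : Stuck G W) (hW : Paired G W) (hv : v ∈ W)
    (h2 : 2 ≤ (whiteNbrs G W v).card) : GoodMove G W v := by
  have hc := le_antisymm (hst.card_whiteNbrs_le_two hW hv) h2
  obtain ⟨a, c, hac, hN⟩ := card_eq_two.1 hc
  have hA : hits G W v = {v, a, c} := by rw [hits_of_mem hv, hN]
  have ha : a ∈ whiteNbrs G W v := by simp [hN]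
  have hcN : c ∈ whiteNbrs G W v := by simp [hN]
  obtain ⟨a', ha'W, ha'A, hNa⟩ := hst.exists_next hW hv ha h2
  obtain ⟨c', hc'W, hc'A, hNc⟩ := hst.exists_next hW hv hcN h2
  have haW := (mem_whiteNbrs.1 ha).1
  have hcW := (mem_whiteNbrs.1 hcN).1
  have hva : v ≠ a := fun e => by simp [← e] at ha
  have hvc : v ≠ c := fun e => by simp [← e] at hcN
  have ha'A2 := ha'A
  have hc'A2 := hc'A
  rw [hA] at ha'A2 hc'A2
  simp only [mem_insert, mem_singleton, not_or] at ha'A2 hc'A2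
  obtain ⟨ha'v, ha'a, ha'c⟩ := ha'A2
  obtain ⟨hc'v, hc'a, hc'c⟩ := hc'A2
  have hNa' : whiteNbrs G W a \ hits G W v = {a'} := by
    rw [hNa, hA]; ext y; simp only [mem_sdiff, mem_insert, mem_singleton]
    constructor
    · tauto
    · rintro rfl; tauto
  have hNc' : whiteNbrs G W c \ hits G W v = {c'} := by
    rw [hNc, hA]; ext y; simp only [mem_sdiff, mem_insert, mem_singleton]
    constructor
    · tauto
    · rintro rfl; tauto
  -- Otherwise `a` and `c` leave the same trace, and playing `v` drops 2·3 + 3·2 = 12.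
  have hne : a' ≠ c' := by
    rintro rfl
    have h1 := hW.weight_play_add_le (v := v) (hits G W v) ∅ {v, a} subset_rfl (by simp) (by
      intro y hy
      simp only [mem_insert, mem_singleton] at hy
      rcases hy with rfl | rfl
      · exact ⟨by simp [hA], Or.inl (by rw [hN, hA]; exact subset_insert _ _)⟩
      · refine ⟨by simp [hA], Or.inr (Or.inr ⟨c, by simp [hA], ?_, ?_⟩)⟩
        · simp only [mem_insert, mem_singleton, not_or]
          exact ⟨hvc.symm, hac.symm⟩
        · rw [hNa', hNc'])
    have h3 := hst v (hits_nonempty_of_mem hv)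
    rw [card_pair hva, card_hits_of_mem hv, card_empty, hc] at h1
    omega
  have hca2 : ∀ {x y : V}, x ≠ y → ({x, y} : Finset V).card = 2 := fun h => card_pair h
  obtain ⟨a'', ha''W, ha''A, hNa''⟩ := hst.exists_next hW haW
    (a := a') (by simp [hNa]) (by rw [hNa, hca2 (Ne.symm ha'v)])
  obtain ⟨c'', hc''W, hc''A, hNc''⟩ := hst.exists_next hW hcW
    (a := c') (by simp [hNc]) (by rw [hNc, hca2 (Ne.symm hc'v)])
  rw [hits_of_mem haW, hNa] at ha''A
  rw [hits_of_mem hcW, hNc] at hc''A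
  simp only [mem_insert, mem_singleton, not_or] at ha''A hc''A
  have hg : weight G (play G W v) + 9 ≤ weight G W := by
    have := hW.weight_play_le (hits_nonempty_of_mem (G := G) hv)
    rw [card_hits_of_mem hv, hc] at this
    omega
  have hW1 := paired_play hW v
  have mem1 : ∀ y, y ∈ W → y ≠ v → y ≠ a → y ≠ c → y ∈ play G W v := by
    intro y h1 h2 h3 h4
    rw [play, hA]; simp [*]
  have hta' : {a'} ∈ traces G (play G W v) := by
    have := whiteNbrs_sdiff_mem_traces (G := G) (W := W) (A := hits G W v) (u := a)
      (by simp [hA]) (by simp [hNa'])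
    rwa [hNa'] at this
  have htc' : {c'} ∈ traces G (play G W v) := by
    have := whiteNbrs_sdiff_mem_traces (G := G) (W := W) (A := hits G W v) (u := c)
      (by simp [hA]) (by simp [hNc'])
    rwa [hNc'] at this
  refine hW.goodMove hg fun t ht hW2 ht' => ?_
  -- In this case v, a, a', c', c form a 5-cycle, and after playing `v` the edge a'c' has both ends
  -- as singleton traces.
  by_cases hadj : a'' = c'
  · have hc''a' : c'' = a' := by
      have h1 : c' ∈ whiteNbrs G W a' := by simp [hNa'', hadj]
      have h2 := mem_whiteNbrs_comm ha'W h1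
      rw [hNc''] at h2
      simp only [mem_insert, mem_singleton] at h2
      exact (h2.resolve_left ha'c).symm
    have e1 : whiteNbrs G (play G W v) a' = {c'} := by
      rw [play, whiteNbrs_sdiff, hNa'', hadj, hA]; ext y
      simp only [mem_sdiff, mem_insert, mem_singleton]
      constructor
      · tauto
      · rintro rfl; tauto
    have e2 : whiteNbrs G (play G W v) c' = {a'} := by
      rw [play, whiteNbrs_sdiff, hNc'', hc''a', hA]; ext y
      simp only [mem_sdiff, mem_insert, mem_singleton]
      constructor
      · tauto
      · rintro rfl; tauto
    by_cases hta : t = a'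
    · subst hta
      exact Or.inl (hW1.weight_sdiff_singleton_le hta' (Or.inr (e1 ▸ htc')))
    by_cases htc : t = c'
    · subst htc
      exact Or.inl (hW1.weight_sdiff_singleton_le htc' (Or.inr (e2 ▸ hta')))
    · have m : a' ∈ play G W v \ {t} := by
        simp only [mem_sdiff, mem_singleton]; exact ⟨mem1 a' ha'W ha'v ha'a ha'c, Ne.symm hta⟩
      refine Or.inr ⟨a', hits_nonempty_of_mem m,
        hW2.weight_play_le_of_edge (q' := c') (S := {a'}) m ?_ ?_
          (mem_traces_sdiff_singleton hta' (by simpa using hta)) (by rw [hits_of_mem m]; simp)⟩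
      · rw [whiteNbrs_sdiff, e1]; simpa using Ne.symm htc
      · rw [whiteNbrs_sdiff, e2, hits_of_mem m]
        exact sdiff_subset.trans (by simp)
  · have hc''a' : c'' ≠ a' := by
      rintro rfl
      have h1 : c'' ∈ whiteNbrs G W c' := by simp [hNc'']
      have h2 := mem_whiteNbrs_comm hc'W h1
      rw [hNa''] at h2
      simp only [mem_insert, mem_singleton] at h2
      exact hadj (h2.resolve_left hc'a).symm
    -- On a side that `t` does not touch, `b'` has only `b''` left as undominated neighbour, so
    -- playing `b''` gains 13.
    have side : ∀ b b' b'' : V, hits G W v ⊇ {v, b} → b' ∈ play G W v → b'' ∈ W →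
        b'' ∉ hits G W v → whiteNbrs G W b' = {b, b''} → {b'} ∈ traces G (play G W v) →
        t ≠ b' → t ≠ b'' →
        ∃ d, (hits G (play G W v \ {t}) d).Nonempty ∧
          weight G (play G (play G W v \ {t}) d) + 13 ≤ weight G (play G W v \ {t}) := by
      intro b b' b'' hvb hb' hb'' hb''A hN' htr h1 h2
      have m : b'' ∈ play G W v \ {t} := by
        simp only [mem_sdiff, mem_singleton, play]; exact ⟨⟨hb'', hb''A⟩, Ne.symm h2⟩
      have m' : b' ∈ play G W v \ {t} := mem_sdiff.2 ⟨hb', by simpa using Ne.symm h1⟩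
      have m2 : b'' ∈ whiteNbrs G (play G W v \ {t}) b' := by
        have : b'' ∈ whiteNbrs G W b' := by simp [hN']
        simp only [mem_whiteNbrs] at this ⊢
        exact ⟨m, this.2⟩
      have m3 := mem_whiteNbrs_comm m' m2
      refine ⟨b'', hits_nonempty_of_mem m, hW2.weight_play_le_of_edge m m3 ?_
        (mem_traces_sdiff_singleton htr (by simpa using h1)) ?_⟩
      · rw [hits_of_mem m, whiteNbrs_sdiff, play, whiteNbrs_sdiff, hN']
        intro y hy
        simp only [mem_sdiff, mem_insert, mem_singleton] at hy ⊢
        rcases hy.1.1 with rfl | rfl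
        · exact (hy.1.2 (hvb (by simp))).elim
        · exact Or.inl rfl
      · rw [hits_of_mem m]
        exact singleton_subset_iff.2 (mem_insert_of_mem m3)
    have ha''v : a'' ∉ hits G W v := by
      rw [hA]; simp only [mem_insert, mem_singleton, not_or]
      refine ⟨ha''A.2.1, ha''A.1, ?_⟩
      rintro rfl
      have h1 : a'' ∈ whiteNbrs G W a' := by simp [hNa'']
      have h2 := mem_whiteNbrs_comm ha'W h1
      rw [hNc] at h2
      simp only [mem_insert, mem_singleton] at h2
      tauto
    have hc''v : c'' ∉ hits G W v := by
      rw [hA]; simp only [mem_insert, mem_singleton, not_or]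
      refine ⟨hc''A.2.1, ?_, hc''A.1⟩
      rintro rfl
      have h1 : c'' ∈ whiteNbrs G W c' := by simp [hNc'']
      have h2 := mem_whiteNbrs_comm hc'W h1
      rw [hNa] at h2
      simp only [mem_insert, mem_singleton] at h2
      rcases h2 with h2 | h2
      · exact hc'v h2
      · exact hne h2.symm
    have ma' := mem1 a' ha'W ha'v ha'a ha'c
    have mc' := mem1 c' hc'W hc'v hc'a hc'c
    by_cases hta : t ≠ a' ∧ t ≠ a''
    · exact Or.inr (side a a' a'' (by simp [hA, insert_subset_iff]) ma' ha''W ha''v hNa'' hta'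
        hta.1 hta.2)
    by_cases htc : t ≠ c' ∧ t ≠ c''
    · exact Or.inr (side c c' c'' (by simp [hA, insert_subset_iff]) mc' hc''W hc''v hNc'' htc'
        htc.1 htc.2)
    -- Now `t` touches both sides, so t = a'' = c'' and the component is a 6-cycle. Dominator plays
    -- `t` itself, already dominated, to take the trace {a', c'}.
    have hta2 : t = a'' := by
      by_contra h
      have h1 : t = a' := by by_contra h'; exact hta ⟨h', h⟩
      subst h1
      exact htc ⟨hne, Ne.symm hc''a'⟩
    have htc2 : t = c'' := by
      by_contra h
      have h1 : t = c' := by by_contra h'; exact htc ⟨h', h⟩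
      exact hadj (hta2 ▸ h1)
    subst hta2
    have hta'' : t ≠ a' := fun h => ha''A.2.2 h
    have htc'' : t ≠ c' := hadj
    have hNt : whiteNbrs G W t = {a', c'} := by
      symm
      apply eq_of_subset_of_card_le
      · intro y hy
        simp only [mem_insert, mem_singleton] at hy
        rcases hy with rfl | rfl
        · exact mem_whiteNbrs_comm ha'W (by simp [hNa''])
        · exact mem_whiteNbrs_comm hc'W (by simp [hNc'', htc2])
      · rw [card_pair hne]; exact hst.card_whiteNbrs_le_two hW ha''W
    have e3 : whiteNbrs G (play G W v \ {t}) t = {a', c'} := by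
      rw [whiteNbrs_sdiff, play, whiteNbrs_sdiff, hNt, hA]
      ext y
      simp only [mem_sdiff, mem_insert, mem_singleton]
      constructor
      · tauto
      · rintro (rfl | rfl) <;> tauto
    have e4 : hits G (play G W v \ {t}) t = {a', c'} := by
      rw [hits_of_notMem (by simp), e3]
    refine Or.inr ⟨t, by rw [e4]; simp, hW2.weight_play_le_of_trace hne e4 ?_
      (mem_traces_sdiff_singleton hta' (by simpa using hta'')) (mem_traces.2 ⟨by simp, t, by simp, e3⟩)⟩
    rw [whiteNbrs_sdiff, play, whiteNbrs_sdiff, hNa'', hA]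
    ext y
    simp only [mem_sdiff, mem_insert, mem_singleton, notMem_empty, iff_false]
    tauto

end Stuck

end DominationGame
namespace DominationGame

open Finset

/-! ### Isolated vertices and edges in stuck positions -/

section Matching

set_option linter.unusedSectionVars false

variable {V : Type*} [Fintype V] [DecidableEq V] {G : SimpleGraph V} [DecidableRel G.Adj]
  {W : Finset V} {u v w : V}

/-- If the undominated vertices are independent and all of them are singleton traces, then every
move lowers the weight by `8`. -/
lemma Paired.weight_play_le_of_independent (hW : Paired G W)
    (h0 : ∀ v ∈ W, whiteNbrs G W v = ∅) (h1 : ∀ v ∈ W, {v} ∈ traces G W) {s : V}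
    (hs : (hits G W s).Nonempty) : weight G (play G W s) + 8 ≤ weight G W := by
  by_cases hsW : s ∈ W
  · have e : hits G W s = {s} := by rw [hits_of_mem hsW, h0 s hsW]; simp
    rw [play, e]
    exact hW.weight_sdiff_singleton_le (h1 s hsW) (Or.inl (h0 s hsW))
  -- No vertex gives a new trace, so k ≥ 1 dominated vertices drop 5k + 3.
  · have := hW.weight_play_add_le (v := s) (hits G W s) {hits G W s} (hits G W s) subset_rfl
      (by simp only [mem_singleton, forall_eq]
          exact ⟨mem_traces.2 ⟨hs, s, hsW, (hits_of_notMem hsW).symm⟩, Or.inl subset_rfl⟩)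
      (fun u hu => ⟨hu, Or.inl (by simp [h0 u (hits_subset hu)])⟩)
    have := hs.card_pos
    simp only [card_singleton] at *
    omega

/-- In a stuck position, a trace through an isolated undominated vertex `t` is `{t}` or `{t, q}`
with `q` not isolated. -/
lemma Stuck.trace_of_isolated (hst : Stuck G W) (hW : Paired G W) {t : V} {S : Finset V}
    (ht : whiteNbrs G W t = ∅) (hS : S ∈ traces G W) (htS : t ∈ S) :
    S = {t} ∨ ∃ q, q ≠ t ∧ S = {t, q} ∧ whiteNbrs G W q ≠ ∅ := by
  obtain ⟨x, hx⟩ := exists_hits_eq_of_mem_traces hS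
  have h11 := hst x (by rw [hx]; exact ⟨t, htS⟩)
  -- Isolated vertices leave no trace, so each in `S` adds 3 to the drop from dominating `S`. One of
  -- them forces |S| ≤ 2; two of them would give 13.
  have hle : ∀ R : Finset V, R ⊆ S → (∀ u ∈ R, whiteNbrs G W u = ∅) →
      2 * S.card + 3 + 3 * R.card < 11 := by
    intro R hR hR0
    have := hW.weight_play_add_le (v := x) S {S} R hx.ge
      (by simp only [mem_singleton, forall_eq]; exact ⟨hS, Or.inl hx.ge⟩)
      (fun u hu => ⟨hx ▸ hR hu, Or.inl (by simp [hR0 u hu])⟩)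
    rw [card_singleton] at this
    omega
  have h3 := hle {t} (by simpa using htS) (by simpa using ht)
  rw [card_singleton] at h3
  have hpos : 0 < S.card := card_pos.2 ⟨t, htS⟩
  obtain h1 | h2 : S.card = 1 ∨ S.card = 2 := by omega
  · left
    obtain ⟨y, rfl⟩ := card_eq_one.1 h1
    rw [mem_singleton.1 htS]
  · right
    obtain ⟨q, hq⟩ := card_eq_one.1 (show (S.erase t).card = 1 by
      rw [card_erase_of_mem htS]; omega)
    have hqS : q ∈ S.erase t := by simp [hq]
    refine ⟨q, (mem_erase.1 hqS).1, by rw [← hq, insert_erase htS], fun h => ?_⟩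
    have := hle S subset_rfl (by
      intro u hu
      rw [← insert_erase htS, hq] at hu
      simp only [mem_insert, mem_singleton] at hu
      rcases hu with rfl | rfl <;> assumption)
    omega

/-- No trace is contained in an isolated edge of a stuck position. -/
lemma Stuck.not_trace_subset (hst : Stuck G W) (hW : Paired G W) (hu : u ∈ W)
    (hNu : whiteNbrs G W u = {v}) (hNv : whiteNbrs G W v = {u}) {S : Finset V}
    (hS : S ∈ traces G W) : ¬ S ⊆ {u, v} := by
  intro h
  have e : hits G W u = {u, v} := by rw [hits_of_mem hu, hNu]
  have := hW.weight_play_le_of_edge (q' := v) hu (by simp [hNu]) (by rw [hNv, e]; simp) hS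
    (e ▸ h)
  have := hst u (hits_nonempty_of_mem hu)
  omega

/-- No trace contains an isolated edge of a stuck position. -/
lemma Stuck.notMem_trace (hst : Stuck G W) (hW : Paired G W)
    (hNu : whiteNbrs G W u = {v}) (hNv : whiteNbrs G W v = {u}) {S : Finset V}
    (hS : S ∈ traces G W) (huS : u ∈ S) : v ∉ S := by
  intro hvS
  obtain ⟨x, hx⟩ := exists_hits_eq_of_mem_traces hS
  have huv : u ≠ v := by
    rintro rfl
    exact notMem_whiteNbrs_self (G := G) (W := W) (v := u) (by simp [hNu])
  have := hW.weight_play_add_le (v := x) {u, v} {S} {u, v}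
    (by rw [hx]; simp [insert_subset_iff, huS, hvS])
    (by simp only [mem_singleton, forall_eq]; exact ⟨hS, Or.inl hx.ge⟩)
    (by
      intro y hy
      simp only [mem_insert, mem_singleton] at hy
      rw [hx]
      rcases hy with rfl | rfl
      · exact ⟨huS, Or.inl (by simpa [hNu] using hvS)⟩
      · exact ⟨hvS, Or.inl (by simpa [hNv] using huS)⟩)
  rw [card_pair huv, card_singleton] at this
  have := hst x (by rw [hx]; exact ⟨u, huS⟩)
  omega

variable (G) in
/-- Every component of the graph induced by `W` has at most two vertices. -/
def IsMatched (W : Finset V) : Prop := ∀ v ∈ W, (whiteNbrs G W v).card ≤ 1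

lemma IsMatched.eq_singleton (hm : IsMatched G W) (hu : u ∈ W) (hv : v ∈ whiteNbrs G W u) :
    whiteNbrs G W u = {v} := by
  symm
  apply eq_of_subset_of_card_le (by simpa using hv)
  simpa using hm u hu

lemma IsMatched.eq_singleton_symm (hm : IsMatched G W) (hu : u ∈ W)
    (hv : v ∈ whiteNbrs G W u) : whiteNbrs G W v = {u} :=
  hm.eq_singleton (mem_whiteNbrs.1 hv).1 (mem_whiteNbrs_comm hu hv)

/-- Playing an end `q` of an isolated edge that is undominated and a singleton trace. -/
lemma Paired.weight_play_le_of_isolated_edge {B : Finset V} (hB : Paired G (W \ B)) {q q' : V}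
    (hq : q ∈ W) (hNq : whiteNbrs G W q = {q'}) (hNq' : whiteNbrs G W q' = {q})
    (hqB : q ∉ B) (hqB' : q' ∉ B) (ht : {q} ∈ traces G (W \ B)) :
    (hits G (W \ B) q).Nonempty ∧ weight G (play G (W \ B) q) + 13 ≤ weight G (W \ B) := by
  have m : q ∈ W \ B := by simp [hq, hqB]
  refine ⟨hits_nonempty_of_mem m, hB.weight_play_le_of_edge (q' := q') (S := {q}) m ?_ ?_ ht ?_⟩
  · rw [whiteNbrs_sdiff, hNq]; simp [hqB']
  · rw [whiteNbrs_sdiff, hNq', hits_of_mem m]; exact sdiff_subset.trans (by simp)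
  · rw [hits_of_mem m]; simp

variable (G) in
/-- `{e, q}` is a trace joining an end `e` of the edge `uv` to a non-isolated vertex `q`. -/
def IsLink (W : Finset V) (u v e q : V) : Prop :=
  (e = u ∨ e = v) ∧ q ≠ u ∧ q ≠ v ∧ whiteNbrs G W q ≠ ∅ ∧ {e, q} ∈ traces G W

lemma pair_sdiff_pair {e q : V} (he : e = u ∨ e = v) (h1 : q ≠ u) (h2 : q ≠ v) :
    ({e, q} : Finset V) \ {u, v} = {q} := by
  ext y
  simp only [mem_sdiff, mem_insert, mem_singleton]
  constructor
  · rintro ⟨rfl | rfl, h⟩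
    · exact (h he).elim
    · rfl
  · rintro rfl; exact ⟨Or.inr rfl, by simp [h1, h2]⟩

/-- A trace consisting of `t` and vertices of an isolated edge not containing `t`, where `t` lies
on another isolated edge, is a link. -/
lemma Stuck.exists_isLink (hst : Stuck G W) (hW : Paired G W) (hNu : whiteNbrs G W u = {v})
    (hNv : whiteNbrs G W v = {u}) {t t' : V} (ht : t ∈ W) (htu : t ≠ u) (htv : t ≠ v)
    (hNt : whiteNbrs G W t = {t'}) (hNt' : whiteNbrs G W t' = {t}) {T : Finset V}
    (hT : T ∈ traces G W) (hTt : T \ {u, v} = {t}) : ∃ e, IsLink G W u v e t := by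
  have htT : t ∈ T := (mem_sdiff.1 (hTt ▸ mem_singleton_self t : t ∈ T \ {u, v})).1
  have hsub : ∀ y ∈ T, y = u ∨ y = v ∨ y = t := by
    intro y hy
    by_contra hc
    have : y ∈ T \ {u, v} := by simp only [mem_sdiff, mem_insert, mem_singleton]; tauto
    rw [hTt, mem_singleton] at this
    tauto
  have hex : u ∈ T ∨ v ∈ T := by
    by_contra hc
    refine hst.not_trace_subset hW ht hNt hNt' hT fun y hy => ?_
    rcases hsub y hy with rfl | rfl | rfl
    · tauto
    · tauto
    · simp
  have build : ∀ e, (e = u ∨ e = v) → e ∈ T → (∀ y ∈ T, y = e ∨ y = t) →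
      ∃ e, IsLink G W u v e t := by
    intro e he heT h
    have : T = {e, t} := by
      ext y; simp only [mem_insert, mem_singleton]
      constructor
      · exact h y
      · rintro (rfl | rfl) <;> assumption
    exact ⟨e, he, htu, htv, by simp [hNt], this ▸ hT⟩
  rcases hex with h | h
  · have h' := hst.notMem_trace hW hNu hNv hT h
    refine build u (Or.inl rfl) h fun y hy => ?_
    rcases hsub y hy with rfl | rfl | rfl
    · exact Or.inl rfl
    · exact (h' hy).elim
    · exact Or.inr rfl
  · have h' := hst.notMem_trace hW hNv hNu hT h
    refine build v (Or.inr rfl) h fun y hy => ?_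
    rcases hsub y hy with rfl | rfl | rfl
    · exact (h' hy).elim
    · exact Or.inl rfl
    · exact Or.inr rfl

/-- Dominator can play an isolated edge that does not have exactly one link. -/
lemma Stuck.goodMove_of_links (hst : Stuck G W) (hW : Paired G W) (hm : IsMatched G W)
    (hiso : ∀ v, ∃ w, G.Adj v w) (hu : u ∈ W) (hvu : v ∈ whiteNbrs G W u)
    (hlink : ∀ e q, IsLink G W u v e q →
      ∃ e' q', IsLink G W u v e' q' ∧ ({e', q'} : Finset V) ≠ {e, q}) :
    GoodMove G W u := by
  have hNu := hm.eq_singleton hu hvu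
  have hNv := hm.eq_singleton_symm hu hvu
  have huv : u ≠ v := by rintro rfl; exact notMem_whiteNbrs_self hvu
  have hA : hits G W u = {u, v} := by rw [hits_of_mem hu, hNu]
  have hRpair : ∀ y ∈ ({u, v} : Finset V), y ∈ hits G W u ∧ whiteNbrs G W y ⊆ hits G W u := by
    intro y hy
    simp only [mem_insert, mem_singleton] at hy
    rw [hA]
    rcases hy with rfl | rfl
    · simp [hNu]
    · simp [hNv]
  -- The drop is 2·2 + 3·2 = 10, one short of 11.
  have h10 := hW.weight_play_add_le (v := u) {u, v} ∅ {u, v} hA.ge (by simp)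
    (fun y hy => ⟨(hRpair y hy).1, Or.inl (hRpair y hy).2⟩)
  rw [card_pair huv] at h10
  have hlink_trace : ∀ {e q : V}, IsLink G W u v e q → {q} ∈ traces G (play G W u) := by
    rintro e q ⟨he, h1, h2, -, h⟩
    have := sdiff_mem_traces (A := {u, v}) h (by rw [pair_sdiff_pair he h1 h2]; simp)
    rwa [pair_sdiff_pair he h1 h2, ← hA] at this
  -- Distinct links with the same outer end would merge when the edge is dominated, raising the drop
  -- to 13.
  have hlink_ne : ∀ {e q e' q' : V}, IsLink G W u v e q → IsLink G W u v e' q' →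
      ({e', q'} : Finset V) ≠ {e, q} → q' ≠ q := by
    rintro e q e' q' ⟨he, h1, h2, -, h⟩ ⟨he', -, -, -, h'⟩ hne rfl
    have := hW.weight_play_add_le (v := u) {u, v} {{e, q'}} {u, v} hA.ge (by
        simp only [mem_singleton, forall_eq]
        refine ⟨h, Or.inr ⟨_, h', hne, ?_⟩⟩
        rw [hA, pair_sdiff_pair he h1 h2, pair_sdiff_pair he' h1 h2])
      (fun y hy => ⟨(hRpair y hy).1, Or.inl (hRpair y hy).2⟩)
    rw [card_pair huv, card_singleton] at this
    have := hst u (hits_nonempty_of_mem hu)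
    omega
  have hW1 := paired_play hW u
  have hpartner : ∀ {q q' : V}, q ∈ W → q ≠ u → q ≠ v → q' ∈ whiteNbrs G W q →
      q' ≠ u ∧ q' ≠ v := by
    intro q q' hq h1 h2 h
    have := hm.eq_singleton_symm hq h
    constructor
    · rintro rfl; rw [hNu, singleton_inj] at this; exact h2 this.symm
    · rintro rfl; rw [hNv, singleton_inj] at this; exact h1 this.symm
  refine hW.goodMove (by omega) fun t ht hW2 ht' => ?_
  have htW := (mem_play.1 ht).1
  have htuv : t ≠ u ∧ t ≠ v := by
    have := (mem_sdiff.1 ht).2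
    rw [hA] at this
    simpa using this
  have e2 : play G W u \ {t} = W \ {u, v, t} := by
    rw [play, hA, sdiff_sdiff_left]
    congr 1; ext y; simp
  have win : ∀ q, q ∈ W → q ≠ u → q ≠ v → q ≠ t → whiteNbrs G W q ≠ ∅ →
      whiteNbrs G W q ≠ {t} → {q} ∈ traces G (play G W u \ {t}) →
      ∃ d, (hits G (play G W u \ {t}) d).Nonempty ∧
        weight G (play G (play G W u \ {t}) d) + 13 ≤ weight G (play G W u \ {t}) := by
    intro q hq h1 h2 h3 hNe hNt h6
    obtain ⟨q', hq'⟩ := nonempty_iff_ne_empty.2 hNe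
    have h4 := hpartner hq h1 h2 hq'
    have hNq := hm.eq_singleton hq hq'
    have h5 : q' ≠ t := by rintro rfl; exact hNt hNq
    rw [e2] at hW2 h6 ⊢
    exact ⟨q, hW2.weight_play_le_of_isolated_edge hq hNq (hm.eq_singleton_symm hq hq')
      (by simp [h1, h2, h3]) (by simp [h4.1, h4.2, h5]) h6⟩
  by_cases hNt : whiteNbrs G W t = ∅
  · by_cases htt : {t} ∈ traces G (play G W u)
    · refine Or.inl (hW1.weight_sdiff_singleton_le htt (Or.inl ?_))
      rw [play, whiteNbrs_sdiff, hNt]; simp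
    · right
      obtain ⟨y, hy⟩ := hiso t
      have hyW : y ∉ W := by
        intro h
        have : y ∈ whiteNbrs G W t := by simp [h, hy]
        simp [hNt] at this
      have htS : t ∈ whiteNbrs G W y := by simp [htW, hy.symm]
      have hS : whiteNbrs G W y ∈ traces G W := mem_traces.2 ⟨⟨t, htS⟩, y, hyW, rfl⟩
      have hno : whiteNbrs G W y \ {u, v} ≠ {t} := by
        intro h
        have := sdiff_mem_traces (A := {u, v}) hS (by rw [h]; simp)
        rw [h, ← hA] at this
        exact htt this
      rcases hst.trace_of_isolated hW hNt hS htS with h | ⟨q, hqt, h, hq⟩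
      · refine (hno ?_).elim
        rw [h]; exact sdiff_eq_self_of_disjoint (by simp [htuv.1, htuv.2])
      · have hquv : q ≠ u ∧ q ≠ v := by
          by_contra hc
          have hc : q = u ∨ q = v := by tauto
          refine hno ?_
          rw [h, pair_comm]
          exact pair_sdiff_pair hc htuv.1 htuv.2
        have hqW : q ∈ W := subset_of_mem_traces hS (by simp [h])
        refine win q hqW hquv.1 hquv.2 hqt hq (fun h' => ?_) ?_
        · have := hm.eq_singleton_symm hqW (v := t) (by simp [h'])
          simp [hNt] at this
        · have e : ({t, q} : Finset V) \ {u, v, t} = {q} := by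
            ext y; simp only [mem_sdiff, mem_insert, mem_singleton]
            constructor
            · tauto
            · rintro rfl; tauto
          have := sdiff_mem_traces (A := {u, v, t}) (h ▸ hS) (by rw [e]; simp)
          rwa [e, ← e2] at this
  · obtain ⟨t', ht't⟩ := nonempty_iff_ne_empty.2 hNt
    have hNt' := hm.eq_singleton htW ht't
    have hNt'' := hm.eq_singleton_symm htW ht't
    have ht'uv := hpartner htW htuv.1 htuv.2 ht't
    have hN1 : whiteNbrs G (play G W u) t = {t'} := by
      rw [play, whiteNbrs_sdiff, hNt', hA]
      exact sdiff_eq_self_of_disjoint (by simp [ht'uv.1, ht'uv.2])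
    have htt : {t} ∈ traces G (play G W u) := by
      rcases ht' with h | h
      · simp [hN1] at h
      · exact h
    -- The ends of the played edge leave no trace, so {t} is the remainder of an old trace. A second
    -- link then serves Dominator.
    obtain ⟨e, hL⟩ : ∃ e, IsLink G W u v e t := by
      rcases eq_sdiff_of_mem_traces_sdiff htt with ⟨T, hT, hTt⟩ | ⟨y, hy, hyt⟩
      · rw [hA] at hTt
        exact hst.exists_isLink hW hNu hNv htW htuv.1 htuv.2 hNt' hNt'' hT hTt
      · have := (hRpair y (hA ▸ hy)).2
        rw [sdiff_eq_empty_iff_subset.2 this] at hyt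
        simp at hyt
    obtain ⟨e', q', hL', hne⟩ := hlink e t hL
    have hqt := hlink_ne hL hL' hne
    have hq1 := hlink_trace hL'
    obtain ⟨-, hq'u, hq'v, hq'N, hq'T⟩ := hL'
    by_cases hqt' : q' = t'
    · subst hqt'
      exact Or.inl (hW1.weight_sdiff_singleton_le htt (Or.inr (hN1 ▸ hq1)))
    · right
      have hq'W : q' ∈ W := subset_of_mem_traces hq'T (by simp)
      refine win q' hq'W hq'u hq'v hqt hq'N (fun h => hqt' ?_)
        (mem_traces_sdiff_singleton hq1 (by simpa using hqt.symm))
      have := hm.eq_singleton_symm hq'W (v := t) (by simp [h])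
      rw [hNt', singleton_inj] at this
      exact this.symm

end Matching

end DominationGame
namespace DominationGame

open Finset

/-! ### Existence of a good move -/

section Choice

set_option linter.unusedSectionVars false

variable {V : Type*} [Fintype V] [DecidableEq V] {G : SimpleGraph V} [DecidableRel G.Adj]
  {W : Finset V} {u v w : V}

/-- If `{u, w}` is a link of the isolated edge `uv`, Dominator can dominate any trace through `v`
that is not a link. -/
lemma Stuck.exists_goodMove_of_trace (hst : Stuck G W) (hW : Paired G W)
    (hNu : whiteNbrs G W u = {v}) (hNv : whiteNbrs G W v = {u}) (hwv : w ≠ v) (hwu : w ≠ u)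
    (hNw : whiteNbrs G W w ≠ ∅) (huw : {u, w} ∈ traces G W) {S : Finset V}
    (hS : S ∈ traces G W) (hvS : v ∈ S)
    (hlink : ∀ q, q ≠ u → q ≠ v → whiteNbrs G W q ≠ ∅ → S ≠ {v, q}) :
    ∃ x, (hits G W x).Nonempty ∧ GoodMove G W x := by
  have huW : u ∈ W := subset_of_mem_traces huw (by simp)
  have hwW : w ∈ W := subset_of_mem_traces huw (by simp)
  have hvW : v ∈ W := subset_of_mem_traces hS hvS
  have huS : u ∉ S := hst.notMem_trace hW hNv hNu hS hvS
  obtain ⟨x, hx⟩ := exists_hits_eq_of_mem_traces hS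
  have hxne : (hits G W x).Nonempty := by rw [hx]; exact ⟨v, hvS⟩
  have hne_singleton : S ≠ {v} := fun h =>
    hst.not_trace_subset hW hvW hNv hNu hS (by rw [h]; simp)
  have hpos : 0 < S.card := card_pos.2 ⟨v, hvS⟩
  have hcard1 : S.card ≠ 1 := fun h => by
    obtain ⟨y, rfl⟩ := card_eq_one.1 h
    exact hne_singleton (by rw [mem_singleton.1 hvS])
  have hcard2 : S.card = 2 → ∃ z, z ≠ u ∧ z ≠ v ∧ S = {v, z} ∧ whiteNbrs G W z = ∅ := by
    intro h
    obtain ⟨z, hz⟩ := card_eq_one.1 (show (S.erase v).card = 1 by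
      rw [card_erase_of_mem hvS]; omega)
    have hzS : z ∈ S.erase v := by simp [hz]
    have hzS' := mem_erase.1 hzS
    have hzu : z ≠ u := by rintro rfl; exact huS hzS'.2
    have e : S = {v, z} := by rw [← hz, insert_erase hvS]
    exact ⟨z, hzu, hzS'.1, e, by_contra fun h0 => hlink z hzu hzS'.1 h0 e⟩
  have h11 := hst x hxne
  have hkill : ∀ T ∈ ({S} : Finset (Finset V)), T ∈ traces G W ∧ (T ⊆ hits G W x ∨
      ∃ T' ∈ traces G W, T' ∉ ({S} : Finset (Finset V)) ∧
        T' \ hits G W x = T \ hits G W x) := by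
    simp only [mem_singleton, forall_eq]; exact ⟨hS, Or.inl hx.ge⟩
  -- For |S| ≥ 3 this is 2|S| + 3; for |S| = 2 the other vertex is isolated and the drop is 10.
  have hg : weight G (play G W x) + 9 ≤ weight G W := by
    by_cases h : S.card = 2
    · obtain ⟨z, -, hzv, e, hz⟩ := hcard2 h
      have := hW.weight_play_add_le (v := x) S {S} {z} hx.ge hkill (by simp [hx, e, hz])
      simp only [card_singleton] at this
      omega
    · have := hW.weight_play_add_le (v := x) S {S} ∅ hx.ge hkill (by simp)
      simp only [card_singleton] at this
      omega
  have huw_sdiff : w ∈ S → ({u, w} : Finset V) \ S = {u} := by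
    intro hwS; ext y; simp only [mem_sdiff, mem_insert, mem_singleton]
    constructor
    · rintro ⟨rfl | rfl, h⟩
      · rfl
      · exact (h hwS).elim
    · rintro rfl; exact ⟨Or.inl rfl, huS⟩
  have hNvS : whiteNbrs G W v \ S = {u} := by
    rw [hNv]; exact sdiff_eq_self_of_disjoint (by simpa using huS)
  -- Otherwise |S| ≥ 3, and `v` would leave the same trace {u} as the shrunken link: the drop would
  -- be at least 6 + 3 + 3.
  have hwS : w ∉ S := by
    intro hwS
    have h3 : S.card ≠ 2 := fun h => by
      obtain ⟨z, -, -, e, hz⟩ := hcard2 h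
      rw [e] at hwS
      simp only [mem_insert, mem_singleton] at hwS
      rcases hwS with rfl | rfl
      · exact hwv rfl
      · exact hNw hz
    have := hW.weight_play_add_le (v := x) S {S} {v} hx.ge hkill (by
      simp only [mem_singleton, forall_eq]
      rw [hx]
      exact ⟨hvS, Or.inr (Or.inl ⟨_, huw, by rw [huw_sdiff hwS, hNvS]⟩)⟩)
    simp only [card_singleton] at this
    omega
  have hW1 := paired_play hW x
  have hu1 : {u} ∈ traces G (play G W x) := by
    have := whiteNbrs_sdiff_mem_traces (G := G) (W := W) (u := v) hvS (by rw [hNvS]; simp)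
    rwa [hNvS, ← hx] at this
  have huw1 : {u, w} ∈ traces G (play G W x) := by
    have e : ({u, w} : Finset V) \ S = {u, w} :=
      sdiff_eq_self_of_disjoint (by simp [huS, hwS])
    have := sdiff_mem_traces (A := S) huw (by rw [e]; simp)
    rwa [e, ← hx] at this
  have hNu1 : whiteNbrs G (play G W x) u = ∅ := by
    rw [play, whiteNbrs_sdiff, hNu, hx]; simpa using hvS
  refine ⟨x, hxne, hW.goodMove hg fun t ht hW2 ht' => ?_⟩
  by_cases htu : t = u
  · subst htu
    exact Or.inl (hW1.weight_sdiff_singleton_le hu1 (Or.inl hNu1))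
  by_cases htw : t = w
  · subst htw
    exact Or.inl (hW1.weight_sdiff_singleton_le_of_merge (Ne.symm htu) ht hu1 huw1 ht')
  right
  have hu2 := mem_traces_sdiff_singleton (t := t) hu1 (by simpa using htu)
  have huw2 := mem_traces_sdiff_singleton (t := t) huw1 (by simp [htu, htw])
  obtain ⟨d, hd⟩ := exists_hits_eq_of_mem_traces huw2
  refine ⟨d, by rw [hd]; simp, hW2.weight_play_le_of_trace hwu.symm hd ?_ hu2 huw2⟩
  rw [whiteNbrs_sdiff, hNu1]; simp

lemma isPendant_of_notMem_trace (hu : whiteNbrs G W u = {v})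
    (h : ∀ S ∈ traces G W, u ∉ S) (huW : u ∈ W) : IsPendant G u v := by
  intro y
  constructor
  · intro hy
    by_cases hyW : y ∈ W
    · have : y ∈ whiteNbrs G W u := by simp [hyW, hy]
      simpa [hu] using this
    · have : u ∈ whiteNbrs G W y := by simp [huW, hy.symm]
      exact (h _ (mem_traces.2 ⟨⟨u, this⟩, y, hyW, rfl⟩) this).elim
  · rintro rfl
    have : y ∈ whiteNbrs G W u := by simp [hu]
    exact (mem_whiteNbrs.1 this).2

/-- Without a good move, every isolated edge has a support vertex as one of its ends, which is the
end of its unique link. -/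
lemma Stuck.exists_unique_link (hst : Stuck G W) (hW : Paired G W) (hm : IsMatched G W)
    (hiso : ∀ v, ∃ w, G.Adj v w) (hno : ∀ x, (hits G W x).Nonempty → ¬ GoodMove G W x)
    (hu : u ∈ W) (hvu : v ∈ whiteNbrs G W u) :
    ∃ e f q, ({e, f} : Finset V) = {u, v} ∧ IsLink G W u v e q ∧ e ∈ supports G ∧
      whiteNbrs G W e = {f} ∧ whiteNbrs G W f = {e} ∧
      ∀ e' q', IsLink G W u v e' q' → ({e', q'} : Finset V) = {e, q} := by
  have hNu := hm.eq_singleton hu hvu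
  have hNv := hm.eq_singleton_symm hu hvu
  have hv := (mem_whiteNbrs.1 hvu).1
  have huv : u ≠ v := by rintro rfl; exact notMem_whiteNbrs_self hvu
  obtain ⟨e, q, hL, huniq⟩ : ∃ e q, IsLink G W u v e q ∧
      ∀ e' q', IsLink G W u v e' q' → ({e', q'} : Finset V) = {e, q} := by
    by_contra hc
    push Not at hc
    exact hno u (hits_nonempty_of_mem hu) (hst.goodMove_of_links hW hm hiso hu hvu hc)
  have finish : ∀ f, ({e, f} : Finset V) = {u, v} → f ≠ e → (f = u ∨ f = v) → f ∈ W →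
      whiteNbrs G W e = {f} → whiteNbrs G W f = {e} → e ∈ supports G := by
    intro f hef hfe hf hfW hNe hNf
    have hL' := hL
    obtain ⟨he, hqu, hqv, hNq, hT⟩ := hL
    have hqf : q ≠ f := by rcases hf with rfl | rfl <;> assumption
    have hqe : q ≠ e := by rcases he with rfl | rfl <;> assumption
    -- A trace through `f` would be a second link or provide a good move. Hence `f` has no dominated
    -- neighbour and is a leaf at `e`.
    have hft : ∀ S ∈ traces G W, f ∉ S := by
      intro S hS hfS
      by_cases hlink : ∀ q', q' ≠ e → q' ≠ f → whiteNbrs G W q' ≠ ∅ → S ≠ {f, q'}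
      · obtain ⟨x, hx, hgx⟩ := hst.exists_goodMove_of_trace hW hNe hNf hqf hqe hNq hT hS hfS hlink
        exact hno x hx hgx
      · push Not at hlink
        obtain ⟨q', h1, h2, h3, rfl⟩ := hlink
        have hq' : q' ∉ ({e, f} : Finset V) := by simp [h1, h2]
        rw [hef] at hq'
        simp only [mem_insert, mem_singleton, not_or] at hq'
        have := huniq f q' ⟨hf, hq'.1, hq'.2, nonempty_iff_ne_empty.1 h3, hS⟩
        have hmem : f ∈ ({e, q} : Finset V) := by rw [← this]; simp
        simp only [mem_insert, mem_singleton] at hmem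
        exact hmem.elim hfe (Ne.symm hqf)
    simp only [supports, mem_filter, mem_univ, true_and]
    exact ⟨f, isPendant_of_notMem_trace hNf hft hfW⟩
  rcases hL.1 with rfl | rfl
  · exact ⟨e, v, q, rfl, hL, finish v rfl huv.symm (Or.inr rfl) hv hNu hNv, hNu, hNv, huniq⟩
  · exact ⟨e, u, q, pair_comm _ _, hL,
      finish u (pair_comm _ _) huv (Or.inl rfl) hu hNv hNu, hNv, hNu, huniq⟩

/-- A link between two edges is a link of each. By uniqueness both its ends are support vertices, so
it is a double trace. Playing one end then drops 10 + 1 = 11, contradicting stuckness. -/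
lemma Stuck.exists_goodMove_of_edge (hst : Stuck G W) (hW : Paired G W) (hm : IsMatched G W)
    (hiso : ∀ v, ∃ w, G.Adj v w) (hu : u ∈ W) (hvu : v ∈ whiteNbrs G W u) :
    ∃ x, (hits G W x).Nonempty ∧ GoodMove G W x := by
  by_contra hno
  push Not at hno
  obtain ⟨e, f, w, hef, hL, hes, hNe, hNf, -⟩ :=
    hst.exists_unique_link hW hm hiso hno hu hvu
  obtain ⟨-, hwu, hwv, hNw, hT⟩ := hL
  have hwef : w ≠ e ∧ w ≠ f := by
    have : w ∉ ({e, f} : Finset V) := by rw [hef]; simp [hwu, hwv]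
    simpa using this
  have heW : e ∈ W := subset_of_mem_traces hT (by simp)
  have hwW : w ∈ W := subset_of_mem_traces hT (by simp)
  have hfe : e ≠ f := by
    rintro rfl
    exact notMem_whiteNbrs_self (G := G) (W := W) (v := e) (by simp [hNe])
  obtain ⟨w', hw'⟩ := nonempty_iff_ne_empty.2 hNw
  have hNw' := hm.eq_singleton_symm hwW hw'
  have hew' : e ≠ w' := by
    rintro rfl
    rw [hNe, singleton_inj] at hNw'
    exact hwef.2 hNw'.symm
  obtain ⟨e2, f2, w2, -, hL2, he2s, -, -, huniq⟩ :=
    hst.exists_unique_link hW hm hiso hno hwW hw'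
  have hws : w ∈ supports G := by
    have hLw : IsLink G W w w' w e :=
      ⟨Or.inl rfl, hwef.1.symm, hew', by simp [hNe], by rwa [pair_comm]⟩
    have h1 := huniq w e hLw
    have h2 : e2 ∈ ({w, e} : Finset V) := by rw [h1]; simp
    simp only [mem_insert, mem_singleton] at h2
    rcases h2 with rfl | rfl
    · exact he2s
    · rcases hL2.1 with h | h
      · exact (hwef.1 h.symm).elim
      · exact (hew' h).elim
  have hdouble : {e, w} ∈ doubleTraces G W := by
    refine mem_filter.2 ⟨hT, ?_⟩
    have : ({e, w} : Finset V) ∩ supports G = {e, w} :=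
      inter_eq_left.2 (by simp [insert_subset_iff, hes, hws])
    rw [this, card_pair hwef.1.symm]
  have hA : hits G W e = {e, f} := by rw [hits_of_mem heW, hNe]
  have h1 := hW.card_doubleTraces_sdiff_lt (A := hits G W e) hits_subset hdouble (by
    rw [hA, pair_sdiff_pair (Or.inl rfl) hwef.1 hwef.2]
    exact (card_le_card inter_subset_left).trans_lt (by simp))
  have h2 := card_traces_sdiff_le (G := G) (W := W) (A := hits G W e) ∅ {e, f} (by simp) (by
    intro y hy
    simp only [mem_insert, mem_singleton] at hy
    rw [hA]
    rcases hy with rfl | rfl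
    · exact ⟨by simp, Or.inl (by simp [hNe])⟩
    · exact ⟨by simp, Or.inl (by simp [hNf])⟩)
  have h3 := card_sdiff_add_card_eq_card (hits_subset (G := G) (W := W) (v := e))
  have h4 := hst e (hits_nonempty_of_mem heW)
  have h5 : (hits G W e).card = 2 := by rw [hA, card_pair hfe]
  rw [card_pair hfe, card_empty] at h2
  simp only [weight, play] at h4
  omega

lemma Stuck.exists_goodMove_of_independent (hst : Stuck G W) (hW : Paired G W)
    (hiso : ∀ v, ∃ w, G.Adj v w) (hv : v ∈ W) (h0 : ∀ v ∈ W, whiteNbrs G W v = ∅) :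
    ∃ x, (hits G W x).Nonempty ∧ GoodMove G W x := by
  have h1 : ∀ z ∈ W, {z} ∈ traces G W := by
    intro z hz
    obtain ⟨y, hy⟩ := hiso z
    have hyW : y ∉ W := by
      intro h
      have : y ∈ whiteNbrs G W z := by simp [h, hy]
      simp [h0 z hz] at this
    have hzS : z ∈ whiteNbrs G W y := by simp [hz, hy.symm]
    have hS : whiteNbrs G W y ∈ traces G W := mem_traces.2 ⟨⟨z, hzS⟩, y, hyW, rfl⟩
    rcases hst.trace_of_isolated hW (h0 z hz) hS hzS with h | ⟨q, -, h, hq⟩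
    · exact h ▸ hS
    · exact (hq (h0 q (subset_of_mem_traces hS (by simp [h])))).elim
  have hA : hits G W v = {v} := by rw [hits_of_mem hv, h0 v hv]; simp
  have h8 := hW.weight_play_le_of_independent h0 h1 (hits_nonempty_of_mem hv)
  refine ⟨v, hits_nonempty_of_mem hv, Or.inr ⟨h8, fun s hs => Or.inl ?_⟩⟩
  have := (paired_play hW v).weight_play_le_of_independent
    (fun z hz => by rw [play, whiteNbrs_sdiff, h0 z (mem_play.1 hz).1]; simp)
    (fun z hz => by
      rw [play, hA] at hz ⊢
      rw [mem_sdiff, mem_singleton] at hz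
      exact mem_traces_sdiff_singleton (h1 z hz.1) (by simpa using Ne.symm hz.2)) hs
  omega

/-- Dominator always has a good move. -/
theorem exists_goodMove (hW : Paired G W) (hiso : ∀ v, ∃ w, G.Adj v w) (hne : W.Nonempty) :
    ∃ x, (hits G W x).Nonempty ∧ GoodMove G W x := by
  by_cases hst : Stuck G W
  · by_cases hm : IsMatched G W
    · by_cases h0 : ∀ v ∈ W, whiteNbrs G W v = ∅
      · obtain ⟨v, hv⟩ := hne
        exact hst.exists_goodMove_of_independent hW hiso hv h0
      · push Not at h0
        obtain ⟨u, hu, v, hv⟩ := h0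
        exact hst.exists_goodMove_of_edge hW hm hiso hu hv
    · simp only [IsMatched, not_forall, not_le] at hm
      obtain ⟨v, hv, h2⟩ := hm
      exact ⟨v, hits_nonempty_of_mem hv, hst.goodMove_of_two_le hW hv h2⟩
  · simp only [Stuck, not_forall, not_lt] at hst
    obtain ⟨x, hx, h⟩ := hst
    exact ⟨x, hx, Or.inl h⟩

end Choice

end DominationGame
namespace DominationGame

open Finset

/-! ### From the potential to the number of moves -/

section Game

set_option linter.unusedSectionVars false

variable {V : Type*} [Fintype V] {G : SimpleGraph V}

lemma movesLeft_eq_zero {p : Player} {D : Set V} (h : dominated G D = Set.univ) :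
    movesLeft G p D = 0 := by
  rw [movesLeft, dif_pos h]

lemma Legal.dominated_ne {D : Set V} {v : V} (h : Legal G D v) : dominated G D ≠ Set.univ := by
  intro he
  obtain ⟨w, -, hw⟩ := h
  exact hw (he ▸ Set.mem_univ w)

lemma Legal.movesLeft_dominator_le {D : Set V} {v : V} (h : Legal G D v) :
    movesLeft G .dominator D ≤ 1 + movesLeft G .staller (insert v D) := by
  classical
  rw [movesLeft, dif_neg h.dominated_ne]
  exact Nat.add_le_add_left
    (inf'_le (fun v : {v // Legal G D v} => movesLeft G .staller (insert v.1 D))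
      (mem_univ (⟨v, h⟩ : {v // Legal G D v}))) 1

lemma movesLeft_staller_le {D : Set V} {b : ℕ}
    (h : ∀ v, Legal G D v → 1 + movesLeft G .dominator (insert v D) ≤ b) :
    movesLeft G .staller D ≤ b := by
  classical
  rw [movesLeft]
  split_ifs with hD
  · exact Nat.zero_le _
  · obtain ⟨v, hv⟩ := exists_legal G hD
    have hb := h v hv
    have : ∀ hne, (univ : Finset {v // Legal G D v}).sup' hne
        (fun v => movesLeft G .dominator (insert v.1 D)) ≤ b - 1 := fun hne =>
      sup'_le hne _ fun v _ => by have := h v.1 v.2; omega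
    have := this ⟨⟨v, hv⟩, mem_univ _⟩
    show 1 + _ ≤ b
    omega

variable [DecidableEq V] [DecidableRel G.Adj]

open Classical in
variable (G) in
/-- The vertices not dominated by `D`. -/
noncomputable def undominated (D : Set V) : Finset V := univ.filter (· ∉ dominated G D)

lemma mem_undominated {D : Set V} {w : V} : w ∈ undominated G D ↔ w ∉ dominated G D := by
  simp [undominated]

lemma undominated_insert (D : Set V) (v : V) :
    undominated G (insert v D) = play G (undominated G D) v := by
  ext w
  have e : dominated G (insert v D) = closedNbhd G v ∪ dominated G D := Set.biUnion_insert _ _ _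
  rw [mem_undominated, mem_play, mem_undominated, e]
  simp only [Set.mem_union, closedNbhd, Set.mem_ofPred_eq]
  tauto

lemma legal_iff {D : Set V} {v : V} : Legal G D v ↔ (hits G (undominated G D) v).Nonempty := by
  constructor <;> rintro ⟨w, hw⟩ <;> refine ⟨w, ?_⟩
  · exact mem_hits.2 ⟨mem_undominated.2 hw.2, hw.1⟩
  · exact ⟨(mem_hits.1 hw).2, mem_undominated.1 (mem_hits.1 hw).1⟩

lemma dominated_eq_univ {D : Set V} (h : ¬ (undominated G D).Nonempty) :
    dominated G D = Set.univ := by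
  by_contra hD
  obtain ⟨v, hv⟩ := (Set.ne_univ_iff_exists_notMem _).1 hD
  exact h ⟨v, mem_undominated.2 hv⟩

lemma card_undominated_insert_lt {D : Set V} {v : V} (h : Legal G D v) :
    (undominated G (insert v D)).card < (undominated G D).card := by
  rw [undominated_insert, play]
  obtain ⟨w, hw⟩ := legal_iff.1 h
  exact card_lt_card (sdiff_ssubset hits_subset ⟨w, hw⟩)

lemma paired_insert {D : Set V} (h : Paired G (undominated G D)) (v : V) :
    Paired G (undominated G (insert v D)) := by
  rw [undominated_insert]; exact paired_play h v

/-- A bound for positions with Dominator to move gives one for positions with Staller to move. -/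
lemma Paired.movesLeft_staller_le {D : Set V} (hD : Paired G (undominated G D))
    (h : ∀ v, Legal G D v → 8 * movesLeft G .dominator (insert v D) ≤
      weight G (undominated G (insert v D))) :
    8 * movesLeft G .staller D ≤ weight G (undominated G D) + 3 := by
  -- The surplus 3 is 8 - 5: a move counts 8, and Staller's lowers the weight by at least 5.
  have := DominationGame.movesLeft_staller_le (G := G) (D := D)
    (b := (weight G (undominated G D) + 3) / 8) (fun v hv => by
      have h1 := h v hv
      have h2 := hD.weight_play_le (legal_iff.1 hv)
      have h3 := (legal_iff.1 hv).card_pos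
      rw [undominated_insert] at h1
      omega)
  omega

theorem Paired.movesLeft_le (hiso : ∀ v, ∃ w, G.Adj v w) (n : ℕ) : ∀ D : Set V,
    (undominated G D).card ≤ n → Paired G (undominated G D) →
    8 * movesLeft G .dominator D ≤ weight G (undominated G D) := by
  induction n with
  | zero =>
    intro D hn _
    rw [movesLeft_eq_zero (dominated_eq_univ ?_)]
    · simp
    · rw [← card_pos]; omega
  | succ n ih =>
    intro D hn hD
    by_cases hne : (undominated G D).Nonempty
    · obtain ⟨x, hx, hgood⟩ := exists_goodMove hD hiso hne
      have hxl := legal_iff.2 hx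
      have hlt := card_undominated_insert_lt hxl
      have hle := hxl.movesLeft_dominator_le
      have hD1 := paired_insert hD x
      rcases hgood with h11 | ⟨h8, hreply⟩
      · have := hD1.movesLeft_staller_le fun v hv => by
          have := card_undominated_insert_lt hv
          exact ih _ (by omega) (paired_insert hD1 v)
        rw [← undominated_insert] at h11
        omega
      · rw [← undominated_insert] at h8 hreply
        -- The subtraction of 1 pays for Dominator's move; it is not truncated, since that move
        -- drops at least 8.
        have := DominationGame.movesLeft_staller_le (G := G) (D := insert x D)
          (b := weight G (undominated G D) / 8 - 1) (fun s hs => by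
            have hlt2 := card_undominated_insert_lt hs
            have hD2 := paired_insert hD1 s
            rcases hreply s (legal_iff.1 hs) with h16 | ⟨d, hd, h27⟩
            · rw [← undominated_insert] at h16
              have := ih _ (by omega) hD2
              omega
            · rw [← undominated_insert] at hd
              rw [← undominated_insert, ← undominated_insert] at h27
              have hdl := legal_iff.2 hd
              have hlt3 := card_undominated_insert_lt hdl
              have h1 := hdl.movesLeft_dominator_le
              have hD3 := paired_insert hD2 d
              have := hD3.movesLeft_staller_le fun v hv => by
                have := card_undominated_insert_lt hv
                exact ih _ (by omega) (paired_insert hD3 v)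
              omega)
        omega
    · rw [movesLeft_eq_zero (dominated_eq_univ hne)]
      simp

/-! ### The first phase and the initial position -/

variable (G) in
/-- The potential controlling the first phase of Dominator's strategy. -/
def initialWeight (W : Finset V) : ℕ := 5 * W.card + 4 * (traces G W).card

lemma weight_le_initialWeight (W : Finset V) : weight G W ≤ initialWeight G W := by
  have : (doubleTraces G W).card ≤ (traces G W).card := card_le_card (filter_subset _ _)
  simp only [weight, initialWeight]
  omega

lemma initialWeight_play_le {W : Finset V} {s : V} (hs : (hits G W s).Nonempty) :
    initialWeight G (play G W s) + 5 ≤ initialWeight G W := by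
  have h3 := card_sdiff_add_card_eq_card (hits_subset (G := G) (W := W) (v := s))
  have hpos := hs.card_pos
  simp only [initialWeight, play]
  by_cases hsW : s ∈ W
  · have := card_traces_sdiff_le (G := G) (W := W) (A := hits G W s) ∅ {s} (by simp) (by
      simp only [mem_singleton, forall_eq]
      refine ⟨by simp [hsW], Or.inl ?_⟩
      rw [hits_of_mem hsW]; exact subset_insert _ _)
    simp only [card_empty, card_singleton] at this
    omega
  · have := card_traces_sdiff_le (G := G) (W := W) (A := hits G W s) {hits G W s} ∅ (by
      simp only [mem_singleton, forall_eq]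
      exact ⟨mem_traces.2 ⟨hs, s, hsW, (hits_of_notMem hsW).symm⟩, Or.inl subset_rfl⟩) (by simp)
    simp only [card_empty, card_singleton] at this
    omega

lemma mem_undominated_of_isPendant {D : Set V} {p h : V} (hp : IsPendant G p h)
    (hh : h ∈ undominated G D) : p ∈ undominated G D := by
  rw [mem_undominated] at hh ⊢
  simp only [dominated, closedNbhd, Set.mem_iUnion, Set.mem_ofPred_eq, not_exists] at hh ⊢
  rintro v hv (rfl | h')
  · exact hh p hv (Or.inr ((hp h).2 rfl))
  · exact hh v hv (Or.inl ((hp v).1 h'.symm).symm)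

theorem movesLeft_le_initialWeight (hiso : ∀ v, ∃ w, G.Adj v w) (n : ℕ) : ∀ D : Set V,
    (undominated G D).card ≤ n →
    8 * movesLeft G .dominator D ≤ initialWeight G (undominated G D) := by
  induction n using Nat.strong_induction_on with
  | _ n ih =>
    intro D hn
    by_cases hD : Paired G (undominated G D)
    · exact (hD.movesLeft_le hiso _ D le_rfl).trans (weight_le_initialWeight _)
    · simp only [Paired, not_forall] at hD
      obtain ⟨h, hh, p, hp, hNh⟩ := hD
      have hpW := mem_undominated_of_isPendant hp hh
      have hpN : p ∈ whiteNbrs G (undominated G D) h :=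
        mem_whiteNbrs.2 ⟨hpW, ((hp h).2 rfl).symm⟩
      have hhp : h ≠ p := by rintro rfl; exact notMem_whiteNbrs_self hpN
      have hcard : 2 ≤ (whiteNbrs G (undominated G D) h).card := by
        by_contra hc
        exact hNh (eq_of_subset_of_card_le (by simpa using hpN)
          (by rw [card_singleton]; omega)).symm
      have h1 := card_hits_of_mem (G := G) hh
      have h2 := card_traces_sdiff_le (G := G) (W := undominated G D)
        (A := hits G (undominated G D) h) ∅ {h, p} (by simp) (by
          intro y hy
          simp only [mem_insert, mem_singleton] at hy
          rw [hits_of_mem hh]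
          rcases hy with rfl | rfl
          · exact ⟨mem_insert_self _ _, Or.inl (subset_insert _ _)⟩
          · refine ⟨mem_insert_of_mem hpN, Or.inl fun z hz => ?_⟩
            rw [(hp z).1 (mem_whiteNbrs.1 hz).2]
            exact mem_insert_self _ _)
      rw [card_pair hhp, card_empty] at h2
      have h3 := card_sdiff_add_card_eq_card (hits_subset (G := G) (W := undominated G D) (v := h))
      have hl : Legal G D h := legal_iff.2 (hits_nonempty_of_mem hh)
      have hlt := card_undominated_insert_lt hl
      have hle := hl.movesLeft_dominator_le
      -- Here |A| ≥ 3 vertices are dominated, and neither `h` nor its leaf leaves a trace: 5|A| -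
      -- 4(|A| - 2) = |A| + 8 ≥ 11.
      have h11 : initialWeight G (undominated G (insert h D)) + 11 ≤
          initialWeight G (undominated G D) := by
        rw [undominated_insert]
        simp only [initialWeight, play]
        omega
      have := DominationGame.movesLeft_staller_le (G := G) (D := insert h D)
        (b := initialWeight G (undominated G D) / 8 - 1) (fun s hs => by
          have hlt2 := card_undominated_insert_lt hs
          have h5 := initialWeight_play_le (legal_iff.1 hs)
          rw [← undominated_insert] at h5
          have := ih (undominated G (insert s (insert h D))).card (by omega) _ le_rfl
          omega)
      omega

end Game

end DominationGame

theorem theorem1 {V : Type*} [Fintype V] (G : SimpleGraph V)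
    (hG : ∀ v, ¬ G.IsIsolated v) :
    (DominationGame.gameDominationNumber G : ℝ) ≤ 5 / 8 * (Fintype.card V : ℝ) := by
  classical
  have hiso : ∀ v, ∃ w, G.Adj v w := by
    intro v
    by_contra h
    push Not at h
    exact hG v h
  have hU : DominationGame.undominated G ∅ = Finset.univ := by
    ext w
    simp [DominationGame.mem_undominated, DominationGame.dominated]
  have h := DominationGame.movesLeft_le_initialWeight hiso _ ∅ le_rfl
  -- No vertex is dominated at the start, so the initial potential is exactly 5n.
  have ht : DominationGame.traces G Finset.univ = ∅ := by
    simp [DominationGame.traces]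
  rw [hU, DominationGame.initialWeight, ht, Finset.card_empty, Finset.card_univ] at h
  have h' : (8 * DominationGame.gameDominationNumber G : ℝ) ≤ 5 * Fintype.card V := by
    exact_mod_cast h
  linarith
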